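/- **Model.** An instance consists of a finite nonempty set $I$ of resources, arrivals $t=1,\dots,n$ at times $a(1)\le\dots\le a(n)$, a set $E$ of edges $(i,t)$, and for each resource $i$ a capacity (number of identical units) $c_i\in\{1,2,\dots\}$, a reward $r_i\ge 0$ and a probability distribution on $[0,\infty]$ of usage durations, with distribution function $F_i(x)=\Pr[d\le x]$ for finite $x\ge 0$. A unit of $i$ that is matched to $t$ earns $r_i$, is used for a random duration $d_{it}\sim F_i$, independent of all other durations, and is available again from time $a(t)+d_{it}$ on (for later arrivals). $\mathrm{OPT}$ is the supremum of the expected total reward over all clairvoyant policies: these know the whole instance in advance, match the arrivals in order, each to at most one adjacent resource with an available unit, and observe a usage duration only when the unit returns. **Algorithm GUIDE.** The units of $i$ are ranked $k=1,\dots,c_i$. For each unit $k_i$ the algorithm maintains an available fraction $Y(k_i)$, initially $1$, and it determines the fraction $y(k_i,t)$ of the unit that is matched to $t$. When $t$ arrives: 1. (Fluid return.) Exactly the proportion $F_i(a(t)-a(\tau))$ of each $y(k_i,\tau)$, $\tau<t$, has returned by now; that is, $Y(k_i)$ is increased by $\sum_{\tau<t}\big(\rho_i(\tau,t)-\rho_i(\tau,t-1)\big)\,y(k_i,\tau)$,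 where $\rho_i(\tau,s)=F_i(a(s)-a(\tau))$ for $\tau<s$ and $\rho_i(\tau,s)=0$ for $\tau\ge s$. 2. (Matching.) Set $\eta=0$ and $y(k_i,t)=0$ for all units. While $\eta<1$ and some resource $i$ with $(i,t)\in E$ has a unit with $Y(k_i)>0$: for each such $i$ let $z_i=\max\{k: Y(k_i)>0\}$; choose such an $i$ that maximizes the reduced price $r_i\big(1-e^{-z_i/c_i}\big)$ (ties broken arbitrarily); let $z$ be its unit of rank $z_i$ and $m=\min\{Y(z),1-\eta\}$; set $y(z,t)=m$, increase $\eta$ by $m$ and decrease $Y(z)$ by $m$. Let $x_{it}=\sum_{k=1}^{c_i}y(k_i,t)$ and let $\mathrm{GUIDE}=\sum_{i,t} r_i x_{it}$ be the total reward of the algorithm. **Lemma.** For every instance and every tie-breaking rule, $$\mathrm{GUIDE}\;\ge\;\Big(\min_{i\in I}\big(c_i(e^{1/c_i}-1)\big)^{-1}\Big)\Big(1-\frac1e\Big)\,\mathrm{OPT}\;\ge\; e^{-1/c_{\min}}\Big(1-\frac1e\Big)\,\mathrm{OPT},\qquad c_{\min}=\min_{i\in I}c_i .$$ -/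

import Mathlib

open MeasureTheory
open scoped ENNReal

noncomputable section

/-- An instance of online vertex-weighted bipartite matching with reusable resources: finitely many
resources `I`, arrivals `0, 1, …, n - 1` in order of arrival, edges, capacities, per-match rewards,
usage-duration distributions on `[0, ∞]` (the value `∞` means that the unit never returns),
and arrival times. -/
structure ReusableInstance (I : Type*) (n : ℕ) where
  edge : I → Fin n → Prop
  c : I → ℕ
  c_pos : ∀ i, 0 < c i
  r : I → ℝ
  r_nonneg : ∀ i, 0 ≤ r i
  F : I → Measure ℝ≥0∞
  F_prob : ∀ i, IsProbabilityMeasure (F i)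
  a : Fin n → ℝ
  a_mono : Monotone a

namespace ReusableInstance

variable {I : Type*} {n : ℕ} (G : ReusableInstance I n)

/-- The cumulative distribution function of the usage duration of `i`, at `x ≥ 0`. -/
def cdf (i : I) (x : ℝ) : ℝ := (G.F i (Set.Iic (ENNReal.ofReal x))).toReal

/-! ### The clairvoyant benchmark -/

/-- A realization of the usage durations: `d (i, t)` is the time for which arrival `t` keeps the unit
of `i` that it receives, if it is matched to `i`. -/
abbrev Durations (_G : ReusableInstance I n) : Type _ := I × Fin n → ℝ≥0∞

/-- All usage durations are independent, and `d (i, t)` has distribution `F i`. -/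
def durationLaw [Fintype I] : Measure G.Durations :=
  haveI := G.F_prob
  Measure.pi fun p : I × Fin n => G.F p.1

/-- A (deterministic) clairvoyant policy. It is chosen with full knowledge of the instance, matches the
arrivals in order, each to at most one adjacent resource that has an available unit, and observes
a usage duration only when the unit returns. `assign d t` is the resource matched to `t` when the
durations are `d`. -/
structure Policy where
  assign : G.Durations → Fin n → Option I
  measurableSet_assign : ∀ t i, MeasurableSet {d | assign d t = some i}
  edge_of_assign : ∀ d t i, assign d t = some i → G.edge i t
  /-- When `t` is matched to `i`, fewer than `c i` units of `i` are in use. The unit given to `s` is in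
  use at the later arrival `t` iff `a s + d (i, s) > a t`. -/
  capacity : ∀ d t i, assign d t = some i →
    Set.ncard {s | s < t ∧ assign d s = some i ∧ ENNReal.ofReal (G.a t - G.a s) < d (i, s)} < G.c i
  /-- If the earlier decisions coincide, and each earlier match has either returned by the time of `t`
  after the same duration in both realizations, or not returned in either of them, then the
  decision at `t` is the same. -/
  nonanticipating : ∀ d d' t,
    (∀ s < t, assign d s = assign d' s ∧
      ∀ i, assign d s = some i →
        d (i, s) = d' (i, s) ∨
          (ENNReal.ofReal (G.a t - G.a s) < d (i, s) ∧
            ENNReal.ofReal (G.a t - G.a s) < d' (i, s))) →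
    assign d t = assign d' t

/-- The reward of an assignment of arrivals: `r i` for every arrival that is matched to `i`. -/
def assignReward (m : Fin n → Option I) : ℝ := ∑ t, (m t).elim 0 G.r

/-- The expected total reward of a clairvoyant policy. -/
def Policy.reward [Fintype I] {G : ReusableInstance I n} (P : G.Policy) : ℝ :=
  ∫ d, G.assignReward (P.assign d) ∂G.durationLaw

/-- `OPT`: the optimal expected total reward of a clairvoyant policy. -/
def opt [Fintype I] : ℝ := ⨆ P : G.Policy, P.reward

/-- The policy that matches nothing. -/
instance : Inhabited G.Policy where
  default :=
    { assign := fun _ _ => none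
      measurableSet_assign := by simp
      edge_of_assign := by simp
      capacity := by simp
      nonanticipating := by simp }

/-- The supremum that defines `opt` is that of a bounded set. -/
theorem bddAbove_reward [Fintype I] : BddAbove (Set.range fun P : G.Policy => P.reward) := by
  have := G.F_prob
  have : IsProbabilityMeasure G.durationLaw := by
    unfold durationLaw; infer_instance
  have hS : 0 ≤ ∑ i, G.r i := Finset.sum_nonneg fun i _ => G.r_nonneg i
  refine ⟨n * ∑ i, G.r i, ?_⟩
  rintro _ ⟨P, rfl⟩
  have h1 : ∀ d, ‖G.assignReward (P.assign d)‖ ≤ n * ∑ i, G.r i := by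
    intro d
    have hn : ∀ t, 0 ≤ ((P.assign d t).elim 0 G.r) ∧
        ((P.assign d t).elim 0 G.r) ≤ ∑ i, G.r i := by
      intro t
      cases P.assign d t with
      | none => simpa using hS
      | some i => exact ⟨G.r_nonneg i,
          Finset.single_le_sum (f := G.r) (fun j _ => G.r_nonneg j) (Finset.mem_univ i)⟩
    rw [assignReward, Real.norm_of_nonneg (Finset.sum_nonneg fun t _ => (hn t).1)]
    calc ∑ t, (P.assign d t).elim 0 G.r ≤ ∑ _t : Fin n, ∑ i, G.r i :=
          Finset.sum_le_sum fun t _ => (hn t).2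
      _ = n * ∑ i, G.r i := by simp
  have h2 := norm_integral_le_of_norm_le_const (μ := G.durationLaw)
    (Filter.Eventually.of_forall h1)
  rw [probReal_univ, mul_one] at h2
  exact (le_abs_self _).trans h2

/-! ### The fluid algorithm -/

/-- The units: `⟨i, k⟩` is the unit of resource `i` of rank `k + 1 ∈ {1, …, c i}`. -/
abbrev Units (G : ReusableInstance I n) : Type _ := Σ i : I, Fin (G.c i)

/-- The reduced price `r_i (1 - g (k / c_i))`, `g x = e^{-x}`, of the unit of `i` of rank `k`. -/
def price (u : G.Units) : ℝ :=
  G.r u.1 * (1 - Real.exp (-(((u.2 : ℕ) + 1 : ℝ) / (G.c u.1 : ℝ))))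

/-- Given the available fractions `Y`, the unit `u` belongs to a neighbour of `t` and is the highest
available unit of its resource. -/
def IsCandidate (t : Fin n) (Y : G.Units → ℝ) (u : G.Units) : Prop :=
  G.edge u.1 t ∧ 0 < Y u ∧ ∀ k, 0 < Y ⟨u.1, k⟩ → k ≤ u.2

/-- The state during the processing of one arrival: the fraction `η` of the arrival that is matched so
far, the available fractions `Y` of the units, and the fractions `y` of the units that are
matched to this arrival. -/
structure LoopState where
  η : ℝ
  Y : G.Units → ℝ
  y : G.Units → ℝ

/-- The selection rule of the algorithm: whenever some neighbour of `t` has a unit with a positive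
available fraction, `sel` returns the highest available unit of a neighbour with the largest
reduced price. Ties may be broken in any way. -/
def IsGreedyRule (sel : Fin n → G.LoopState → G.Units) : Prop :=
  ∀ t st, (∃ u, G.IsCandidate t st.Y u) →
    G.IsCandidate t st.Y (sel t st) ∧
      ∀ v, G.IsCandidate t st.Y v → G.price v ≤ G.price (sel t st)

/-- A selection rule exists. -/
theorem exists_isGreedyRule [Fintype I] [Nonempty I] :
    ∃ sel : Fin n → G.LoopState → G.Units, G.IsGreedyRule sel := by
  classical
  have hne : Nonempty G.Units := ‹Nonempty I›.map fun i => ⟨i, ⟨0, G.c_pos i⟩⟩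
  have h : ∀ (t : Fin n) (st : G.LoopState), ∃ w : G.Units, (∃ u, G.IsCandidate t st.Y u) →
      G.IsCandidate t st.Y w ∧ ∀ v, G.IsCandidate t st.Y v → G.price v ≤ G.price w := by
    intro t st
    by_cases hc : ∃ u, G.IsCandidate t st.Y u
    · obtain ⟨u, hu⟩ := hc
      obtain ⟨w, hw, hmax⟩ := Finset.exists_max_image
        (Finset.univ.filter fun u => G.IsCandidate t st.Y u) G.price ⟨u, by simpa using hu⟩
      exact ⟨w, fun _ => ⟨by simpa using hw, fun v hv => hmax v (by simpa using hv)⟩⟩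
    · exact ⟨hne.some, fun h => absurd h hc⟩
  choose sel hsel using h
  exact ⟨sel, fun t st => hsel t st⟩

open Classical in
/-- One pass of the while loop; the state is left unchanged once the loop has ended. -/
def pass (sel : Fin n → G.LoopState → G.Units) (t : Fin n) (st : G.LoopState) : G.LoopState :=
  if st.η < 1 ∧ ∃ u, G.IsCandidate t st.Y u then
    let u := sel t st
    let m := min (st.Y u) (1 - st.η)
    { η := st.η + m
      Y := Function.update st.Y u (st.Y u - m)
      y := Function.update st.y u m }
  else st

/-- The while loop. A pass exhausts a unit or ends the loop, so that as many passes as there are units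
run it to its end (`loop_ended`). -/
def loop [Fintype I] (sel : Fin n → G.LoopState → G.Units) (t : Fin n) (st : G.LoopState) :
    G.LoopState :=
  (G.pass sel t)^[Fintype.card G.Units] st

theorem loop_ended [Fintype I] {sel : Fin n → G.LoopState → G.Units} (hsel : G.IsGreedyRule sel)
    (t : Fin n) (st : G.LoopState) :
    ¬ ((G.loop sel t st).η < 1 ∧ ∃ u, G.IsCandidate t (G.loop sel t st).Y u) := by
  classical
  let M : G.LoopState → ℕ := fun s => (Finset.univ.filter fun u => 0 < s.Y u).card
  have key : ∀ m : ℕ, ∀ s : G.LoopState, M s ≤ m →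
      ¬ (((G.pass sel t)^[m] s).η < 1 ∧ ∃ u, G.IsCandidate t ((G.pass sel t)^[m] s).Y u) := by
    intro m
    induction m with
    | zero =>
      rintro s hs ⟨-, u, hu⟩
      have : u ∈ (Finset.univ.filter fun u => 0 < s.Y u) := by simpa using hu.2.1
      have := Finset.card_pos.2 ⟨u, this⟩
      exact absurd hs (by simp only [M]; omega)
    | succ m ih =>
      intro s hs
      rw [Function.iterate_succ_apply]
      have fix : ∀ s' : G.LoopState, ¬ (s'.η < 1 ∧ ∃ u, G.IsCandidate t s'.Y u) →
          ((G.pass sel t)^[m] s') = s' := fun s' h =>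
        Function.iterate_fixed (by unfold pass; rw [if_neg h]) m
      by_cases hc : s.η < 1 ∧ ∃ u, G.IsCandidate t s.Y u
      · have hcand := (hsel t s hc.2).1
        by_cases hle : s.Y (sel t s) ≤ 1 - s.η
        · apply ih
          have hY : (G.pass sel t s).Y = Function.update s.Y (sel t s) 0 := by
            unfold pass; rw [if_pos hc]; simp [min_eq_left hle]
          have : M (G.pass sel t s) < M s := by
            apply Finset.card_lt_card
            rw [Finset.ssubset_iff_of_subset]
            · exact ⟨sel t s, by simpa using hcand.2.1, by simp [hY]⟩
            · intro u
              by_cases hu : u = sel t s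
              · subst hu; simp [hY]
              · simp [hY, Function.update_of_ne hu]
          omega
        · have hη : (G.pass sel t s).η = 1 := by
            unfold pass; rw [if_pos hc]; simp [min_eq_right (not_le.1 hle).le]
          have hend : ¬ ((G.pass sel t s).η < 1 ∧ ∃ u, G.IsCandidate t (G.pass sel t s).Y u) := by
            simp [hη]
          rw [fix _ hend]; exact hend
      · have hp : G.pass sel t s = s := by unfold pass; rw [if_neg hc]
        rw [hp, fix s hc]; exact hc
  exact key _ st (Finset.card_le_univ _)

/-- The state between arrivals: the available fractions `Y` of the units, and the fractions `y u τ` of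
the units `u` that have been matched to the arrivals `τ` so far. -/
structure GuideState where
  Y : G.Units → ℝ
  y : G.Units → Fin n → ℝ

/-- Of what arrival `τ` received from resource `i`, the proportion that has returned when the inventory
is updated at arrival `s`. This update precedes the matching of `s`, so nothing that is matched at
`τ` has returned at the update of an arrival `s ≤ τ`. -/
def returned (i : I) (τ s : Fin n) : ℝ := if τ < s then G.cdf i (G.a s - G.a τ) else 0

/-- The fluid update of the inventory at arrival `t`, from its value just after the preceding arrival
(the sum is empty for the first arrival). -/
def fluidUpdate (t : Fin n) (s : G.GuideState) (u : G.Units) : ℝ :=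
  s.Y u + ∑ τ ∈ Finset.univ.filter (fun τ => τ < t),
    (G.returned u.1 τ t - G.returned u.1 τ ⟨(t : ℕ) - 1, by omega⟩) * s.y u τ

/-- The processing of arrival `t`: inventory update, then fractional matching. -/
def arrivalStep [Fintype I] (sel : Fin n → G.LoopState → G.Units) (t : Fin n) (s : G.GuideState) :
    G.GuideState :=
  let st := G.loop sel t { η := 0, Y := G.fluidUpdate t s, y := fun _ => 0 }
  { Y := st.Y
    y := fun u => Function.update (s.y u) t (st.y u) }

/-- The state of the algorithm after the first `m` arrivals. -/
def guideState [Fintype I] (sel : Fin n → G.LoopState → G.Units) : ℕ → G.GuideState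
  | 0 => { Y := fun _ => 1, y := fun _ _ => 0 }
  | m + 1 =>
    if h : m < n then G.arrivalStep sel ⟨m, h⟩ (guideState sel m) else guideState sel m

/-- The output `x i t` of the algorithm: the total fraction of `i` that is matched to arrival `t`. -/
def guideMatch [Fintype I] (sel : Fin n → G.LoopState → G.Units) (i : I) (t : Fin n) : ℝ :=
  ∑ k : Fin (G.c i), (G.guideState sel n).y ⟨i, k⟩ t

/-- The total reward of the algorithm. -/
def guide [Fintype I] (sel : Fin n → G.LoopState → G.Units) : ℝ :=
  ∑ i, ∑ t, G.r i * G.guideMatch sel i t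

end ReusableInstance

end

/-! The proof is a primal-dual argument against a fixed policy with matching probabilities p(i,t).
Each match of GUIDE is split in two: arrival t keeps λ(t), the reduced prices it collects
(`payment`), and resource i keeps θ(i), the complementary share r_i e^{-k/c_i} of what its unit of
rank k earns. Thus GUIDE = Σ λ(t) + Σ θ(i) (`guide_eq`). The crux is `dual_feasible`: (1 - 1/e) r_i
Σ_t p(i,t) ≤ Σ_t p(i,t) λ(t) + c_i (e^{1/c_i} - 1) θ(i). Summation over i, with Σ_i p(i,t) ≤ 1, then
gives the bound.

Let z be the highest rank of i still available after the matching of a neighbour t. Greediness gives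
λ(t) ≥ r_i (1 - e^{-z/c_i}), and the shortfall e^{-z/c_i} - e^{-1} is e^{1/c_i} - 1 times the
geometric sum of e^{-k/c_i} over k > z, whose units are all depleted (`r_le_payment_add`). It
remains to show, for each unit, that the policy's mass on the arrivals at which the unit is depleted
is at most c_i times the mass that GUIDE matches from it.

Since units return, this is not a plain count. Both masses are seen through one matrix, the
proportion 1 - F_i(a(t) - a(τ)) still in use at t. The policy loads every row by at most c_i,
because a duration is independent of the decision that starts it (`sum_inUse_mul_matchProb_le`);
GUIDE loads each depleted row by at least 1. Nonnegative row weights that make the columns of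
depleted arrivals sum to 1, and all others to at most 1, turn the two row bounds into the comparison
of masses (`sum_le_mul_sum_of_load`). -/

/-! ### Triangular load matrices -/

/-- Dual weights for a lower triangular matrix whose rows increase towards a unit diagonal. -/
theorem exists_dual_weights {ι : Type*} [LinearOrder ι] (A : ι → ι → ℝ)
    (hdiag : ∀ t, A t t = 1) (hmono : ∀ t τ τ', τ ≤ τ' → τ' ≤ t → A t τ ≤ A t τ')
    (S : Finset ι) :
    ∃ μ : ι → ℝ, (∀ t, 0 ≤ μ t) ∧ (∀ τ ∈ S, ∑ t ∈ S with τ ≤ t, A t τ * μ t = 1) ∧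
      ∀ τ, ∑ t ∈ S with τ ≤ t, A t τ * μ t ≤ 1 := by
  induction S using Finset.induction_on_min with
  | empty => exact ⟨fun _ => 0, by simp, by simp, by simp⟩
  | insert a S ha ih =>
    obtain ⟨μ, h0, h1, h2⟩ := ih
    have haS : a ∉ S := fun h => lt_irrefl _ (ha a h)
    have hfil : S.filter (fun t => a ≤ t) = S := Finset.filter_true_of_mem fun t ht => (ha t ht).le
    -- The bound for columns outside `S` is carried through the induction for this use: it makes the
    -- new weight below nonnegative.
    have h2a := h2 a
    rw [hfil] at h2a
    -- Back substitution: row `a` does not meet the columns of `S`, all later than `a`, so its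
    -- weight is free to complete column `a` to 1.
    let ν : ι → ℝ := Function.update μ a (1 - ∑ t ∈ S, A t a * μ t)
    have hνa : ν a = 1 - ∑ t ∈ S, A t a * μ t := Function.update_self ..
    have hνS : ∀ t ∈ S, ν t = μ t := fun t ht =>
      Function.update_of_ne (ha t ht).ne' _ _
    have hν0 : ∀ t, 0 ≤ ν t := by
      intro t
      by_cases h : t = a
      · subst h; rw [hνa]; linarith
      · simpa [ν, Function.update_of_ne h] using h0 t
    have hgt : ∀ τ, a < τ → ∑ t ∈ insert a S with τ ≤ t, A t τ * ν t =
        ∑ t ∈ S with τ ≤ t, A t τ * μ t := by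
      intro τ hτ
      rw [Finset.filter_insert, if_neg (not_le.2 hτ)]
      exact Finset.sum_congr rfl fun t ht => by rw [hνS t (Finset.mem_filter.1 ht).1]
    have hsumS : ∀ τ, ∑ t ∈ S, A t τ * ν t = ∑ t ∈ S, A t τ * μ t := fun τ =>
      Finset.sum_congr rfl fun t ht => by rw [hνS t ht]
    have hle : ∀ τ, τ ≤ a → ∑ t ∈ insert a S with τ ≤ t, A t τ * ν t =
        A a τ * ν a + ∑ t ∈ S, A t τ * ν t := by
      intro τ hτ
      rw [Finset.filter_true_of_mem, Finset.sum_insert haS]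
      intro t ht
      rcases Finset.mem_insert.1 ht with rfl | ht
      · exact hτ
      · exact hτ.trans (ha t ht).le
    have hat : ∑ t ∈ insert a S with a ≤ t, A t a * ν t = 1 := by
      rw [hle a le_rfl, hsumS, hdiag, hνa]; ring
    refine ⟨ν, hν0, ?_, ?_⟩
    · intro τ hτ
      rcases Finset.mem_insert.1 hτ with rfl | hτ
      · exact hat
      · rw [hgt τ (ha τ hτ)]; exact h1 τ hτ
    · intro τ
      rcases le_or_gt τ a with h | h
      -- Column `τ` is dominated entrywise by column `a`, which sums to 1.
      · rw [hle τ h, ← hat, hle a le_rfl]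
        refine add_le_add (mul_le_mul_of_nonneg_right (hmono _ _ _ h le_rfl) (hν0 a))
          (Finset.sum_le_sum fun t ht => ?_)
        exact mul_le_mul_of_nonneg_right (hmono _ _ _ h (ha t ht).le) (hν0 t)
      · rw [hgt τ h]; exact h2 τ

/-- If `o` loads every row by at most `C`, and `y` loads every row in `S` by at least `1`,
then the mass of `o` on `S` is at most `C` times the mass of `y`. -/
theorem sum_le_mul_sum_of_load {ι : Type*} [LinearOrder ι] [Fintype ι] (A : ι → ι → ℝ)
    (hdiag : ∀ t, A t t = 1) (hmono : ∀ t τ τ', τ ≤ τ' → τ' ≤ t → A t τ ≤ A t τ')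
    (hA : ∀ t τ, 0 ≤ A t τ) {C : ℝ} (hC : 0 ≤ C)
    (S : Finset ι) (o y : ι → ℝ) (ho : ∀ t, 0 ≤ o t) (hy : ∀ t, 0 ≤ y t)
    (hload : ∀ t, ∑ τ with τ ≤ t, A t τ * o τ ≤ C)
    (hfull : ∀ t ∈ S, 1 ≤ ∑ τ with τ ≤ t, A t τ * y τ) :
    ∑ t ∈ S, o t ≤ C * ∑ t, y t := by
  obtain ⟨μ, h0, h1, h2⟩ := exists_dual_weights A hdiag hmono S
  have swap : ∀ w : ι → ℝ, ∑ t ∈ S, μ t * ∑ τ with τ ≤ t, A t τ * w τ =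
      ∑ τ, w τ * ∑ t ∈ S with τ ≤ t, A t τ * μ t := by
    intro w
    simp_rw [Finset.sum_filter, Finset.mul_sum]
    rw [Finset.sum_comm]
    refine Finset.sum_congr rfl fun τ _ => Finset.sum_congr rfl fun t _ => ?_
    split_ifs <;> ring
  have hcol : ∀ τ, 0 ≤ ∑ t ∈ S with τ ≤ t, A t τ * μ t := fun τ =>
    Finset.sum_nonneg fun t _ => mul_nonneg (hA _ _) (h0 t)
  calc ∑ t ∈ S, o t = ∑ τ ∈ S, o τ * ∑ t ∈ S with τ ≤ t, A t τ * μ t :=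
        Finset.sum_congr rfl fun τ hτ => by rw [h1 τ hτ, mul_one]
    _ ≤ ∑ τ, o τ * ∑ t ∈ S with τ ≤ t, A t τ * μ t :=
        Finset.sum_le_sum_of_subset_of_nonneg (Finset.subset_univ _)
          fun τ _ _ => mul_nonneg (ho τ) (hcol τ)
    _ = ∑ t ∈ S, μ t * ∑ τ with τ ≤ t, A t τ * o τ := (swap o).symm
    _ ≤ ∑ t ∈ S, μ t * C :=
        Finset.sum_le_sum fun t _ => mul_le_mul_of_nonneg_left (hload t) (h0 t)
    _ = C * ∑ t ∈ S, μ t * 1 := by simp [Finset.mul_sum, mul_comm]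
    _ ≤ C * ∑ t ∈ S, μ t * ∑ τ with τ ≤ t, A t τ * y τ :=
        mul_le_mul_of_nonneg_left (Finset.sum_le_sum fun t ht =>
          mul_le_mul_of_nonneg_left (hfull t ht) (h0 t)) hC
    _ = C * ∑ τ, y τ * ∑ t ∈ S with τ ≤ t, A t τ * μ t := by rw [swap y]
    _ ≤ C * ∑ t, y t := mul_le_mul_of_nonneg_left (Finset.sum_le_sum fun τ _ =>
          mul_le_of_le_one_right (hy τ) (h2 τ)) hC

/-! ### Proportions in use and reduced prices -/

namespace ReusableInstance

variable {I : Type*} {n : ℕ} (G : ReusableInstance I n)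

theorem cdf_nonneg (i : I) (x : ℝ) : 0 ≤ G.cdf i x := ENNReal.toReal_nonneg

theorem cdf_le_one (i : I) (x : ℝ) : G.cdf i x ≤ 1 := by
  have := G.F_prob i
  exact measureReal_le_one

theorem cdf_mono (i : I) : Monotone (G.cdf i) := by
  have := G.F_prob i
  intro x y h
  exact measureReal_mono (Set.Iic_subset_Iic.2 (ENNReal.ofReal_le_ofReal h))

/-- The proportion of what arrival `τ` received from `i` that is still in use at arrival `t`. -/
def inUse (i : I) (t τ : Fin n) : ℝ := 1 - G.returned i τ t

theorem inUse_self (i : I) (t : Fin n) : G.inUse i t t = 1 := by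
  simp [inUse, returned]

theorem inUse_nonneg (i : I) (t τ : Fin n) : 0 ≤ G.inUse i t τ := by
  unfold inUse returned
  split_ifs
  · linarith [G.cdf_le_one i (G.a t - G.a τ)]
  · norm_num

/-- A later match has had less time to return. The case `τ' = t` is separate: nothing matched at `t`
has returned, even if duration 0 has positive probability. -/
theorem inUse_mono (i : I) (t τ τ' : Fin n) (h : τ ≤ τ') (h' : τ' ≤ t) :
    G.inUse i t τ ≤ G.inUse i t τ' := by
  unfold inUse returned
  rcases h'.eq_or_lt with rfl | h'
  · rw [if_neg (lt_irrefl τ')]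
    split_ifs
    · linarith [G.cdf_nonneg i (G.a τ' - G.a τ)]
    · exact le_rfl
  · rw [if_pos h', if_pos (h.trans_lt h')]
    have := G.cdf_mono i (show G.a t - G.a τ' ≤ G.a t - G.a τ by linarith [G.a_mono h])
    linarith

theorem price_nonneg (u : G.Units) : 0 ≤ G.price u := by
  refine mul_nonneg (G.r_nonneg _) (sub_nonneg.2 (Real.exp_le_one_iff.2 ?_))
  exact neg_nonpos.2 (by positivity)

theorem price_mono (i : I) {k l : Fin (G.c i)} (h : k ≤ l) :
    G.price ⟨i, k⟩ ≤ G.price ⟨i, l⟩ := by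
  refine mul_le_mul_of_nonneg_left (sub_le_sub_left (Real.exp_le_exp.2 (neg_le_neg ?_)) _)
    (G.r_nonneg _)
  have : ((k : ℕ) : ℝ) ≤ ((l : ℕ) : ℝ) := by exact_mod_cast h
  dsimp only
  gcongr

variable {G}

/-- Above every available unit of a neighbour there is a candidate, of at least the same price. -/
theorem exists_isCandidate_price_le {t : Fin n} {Y : G.Units → ℝ} {v : G.Units}
    (hv : G.edge v.1 t) (hY : 0 < Y v) : ∃ w, G.IsCandidate t Y w ∧ G.price v ≤ G.price w := by
  classical
  obtain ⟨i, k⟩ := v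
  obtain ⟨l, hl, hmax⟩ := Finset.exists_max_image
    (Finset.univ.filter fun k : Fin (G.c i) => 0 < Y ⟨i, k⟩) id ⟨k, by simpa using hY⟩
  refine ⟨⟨i, l⟩, ⟨hv, (Finset.mem_filter.1 hl).2, fun j hj => hmax j (by simpa using hj)⟩, ?_⟩
  exact G.price_mono i (hmax k (by simpa using hY))

theorem IsGreedyRule.price_le {sel : Fin n → G.LoopState → G.Units} (hsel : G.IsGreedyRule sel)
    {t : Fin n} {st : G.LoopState} {v : G.Units} (hv : G.edge v.1 t) (hY : 0 < st.Y v) :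
    G.price v ≤ G.price (sel t st) := by
  obtain ⟨w, hw, hle⟩ := exists_isCandidate_price_le hv hY
  exact hle.trans ((hsel t st ⟨w, hw⟩).2 w hw)

/-! ### Greedy matching of a single arrival -/

/-- The invariant of the while loop at arrival `t`, started with the inventory `Y₀`. -/
structure LoopInvariant [Fintype I] (t : Fin n) (Y₀ : G.Units → ℝ) (st : G.LoopState) : Prop where
  add_eq : ∀ u, st.Y u + st.y u = Y₀ u
  unmatched : st.η < 1 → ∀ u, 0 < st.Y u → st.y u = 0
  sum_eq : ∑ u, st.y u = st.η
  nonneg : ∀ u, 0 ≤ st.y u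
  price_le : ∀ u v, 0 < st.y u → G.edge v.1 t → 0 < st.Y v → G.price v ≤ G.price u

/-- A selected unit has not been used for this arrival before, so overwriting its entry of `y`
amounts to adding to it. Inventories only shrink during the loop, so a price that dominated the
available units when its unit was chosen continues to do so. -/
theorem LoopInvariant.pass [Fintype I] {sel : Fin n → G.LoopState → G.Units}
    (hsel : G.IsGreedyRule sel) {t : Fin n} {Y₀ : G.Units → ℝ} {st : G.LoopState}
    (h : LoopInvariant t Y₀ st) : LoopInvariant t Y₀ (G.pass sel t st) := by
  classical
  unfold ReusableInstance.pass
  split_ifs with hc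
  swap
  · exact h
  obtain ⟨hη, hcand⟩ := hc
  have hpos : 0 < st.Y (sel t st) := (hsel t st hcand).1.2.1
  set u₀ := sel t st with hu₀
  have hy0 : st.y u₀ = 0 := h.unmatched hη u₀ hpos
  set m := min (st.Y u₀) (1 - st.η) with hm
  have hm0 : 0 < m := lt_min hpos (sub_pos.2 hη)
  have hYle : ∀ v, 0 < Function.update st.Y u₀ (st.Y u₀ - m) v → 0 < st.Y v := by
    intro v hv
    by_cases hvu : v = u₀
    · rw [hvu]; exact hpos
    · rwa [Function.update_of_ne hvu] at hv
  change LoopInvariant t Y₀ { η := st.η + m, Y := Function.update st.Y u₀ (st.Y u₀ - m),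
                              y := Function.update st.y u₀ m }
  refine ⟨fun u => ?_, fun hη' u hu => ?_, ?_, fun u => ?_, fun u v hu hv hYv => ?_⟩
  · by_cases hu : u = u₀
    · subst hu
      have := h.add_eq u₀
      simp only [Function.update_self]
      linarith
    · simpa only [Function.update_of_ne hu] using h.add_eq u
  -- If the arrival is still not fully matched, the pass was limited by the unit, which is now
  -- exhausted.
  · have hmin : m = st.Y u₀ := by
      rcases min_choice (st.Y u₀) (1 - st.η) with h1 | h1
      · exact h1
      · exfalso
        have h2 : st.η + m < 1 := hη'
        rw [hm, h1] at h2
        linarith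
    by_cases hu' : u = u₀
    · subst hu'
      simp only [Function.update_self, hmin, sub_self, lt_irrefl] at hu
    · simp only [Function.update_of_ne hu'] at hu ⊢
      exact h.unmatched hη u hu
  · rw [Finset.sum_update_of_mem (Finset.mem_univ _), ← h.sum_eq,
      ← Finset.add_sum_erase _ _ (Finset.mem_univ u₀), hy0, Finset.sdiff_singleton_eq_erase]
    ring
  · by_cases hu : u = u₀
    · subst hu
      simpa only [Function.update_self] using hm0.le
    · simpa only [Function.update_of_ne hu] using h.nonneg u
  · by_cases hu' : u = u₀
    · rw [hu']
      exact hsel.price_le hv (hYle v hYv)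
    · simp only [Function.update_of_ne hu'] at hu
      exact h.price_le u v hu hv (hYle v hYv)

theorem LoopInvariant.loop [Fintype I] {sel : Fin n → G.LoopState → G.Units}
    (hsel : G.IsGreedyRule sel) {t : Fin n} {Y₀ : G.Units → ℝ} {st : G.LoopState}
    (h : LoopInvariant t Y₀ st) : LoopInvariant t Y₀ (G.loop sel t st) := by
  unfold ReusableInstance.loop
  generalize Fintype.card G.Units = m
  induction m with
  | zero => exact h
  | succ m ih =>
    rw [Function.iterate_succ_apply']
    exact ih.pass hsel

theorem loopInvariant_init [Fintype I] (t : Fin n) (Y₀ : G.Units → ℝ) :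
    LoopInvariant t Y₀ { η := 0, Y := Y₀, y := fun _ => 0 } :=
  ⟨by simp, by simp, by simp, by simp, by simp⟩

/-- When the loop ends, the arrival has paid at least the price of every remaining unit. -/
theorem LoopInvariant.price_le_sum [Fintype I] {t : Fin n} {Y₀ : G.Units → ℝ} {st : G.LoopState}
    (h : LoopInvariant t Y₀ st) (hend : ¬ (st.η < 1 ∧ ∃ u, G.IsCandidate t st.Y u))
    {v : G.Units} (hv : G.edge v.1 t) (hY : 0 < st.Y v) :
    G.price v ≤ ∑ u, st.y u * G.price u := by
  obtain ⟨w, hw, -⟩ := exists_isCandidate_price_le hv hY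
  -- An available unit remains, so the loop stopped because the arrival was fully matched.
  have hη : 1 ≤ st.η := not_lt.1 fun hlt => hend ⟨hlt, w, hw⟩
  calc G.price v ≤ st.η * G.price v := le_mul_of_one_le_left (G.price_nonneg v) hη
    _ = ∑ u, st.y u * G.price v := by rw [← h.sum_eq, Finset.sum_mul]
    _ ≤ ∑ u, st.y u * G.price u := Finset.sum_le_sum fun u _ => by
      rcases (h.nonneg u).eq_or_lt with h0 | h0
      · simp [← h0]
      · exact mul_le_mul_of_nonneg_left (h.price_le u v h0 hv hY) h0.le

/-! ### Inventory over time -/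

variable (G) in
/-- The fraction of unit `u` that is available after the matching of arrival `t`, if the fractions `y`
are matched. -/
def avail (y : G.Units → Fin n → ℝ) (t : Fin n) (u : G.Units) : ℝ :=
  1 - ∑ τ with τ ≤ t, G.inUse u.1 t τ * y u τ

theorem avail_congr {y y' : G.Units → Fin n → ℝ} {t : Fin n} {u : G.Units}
    (h : ∀ τ ≤ t, y u τ = y' u τ) : G.avail y t u = G.avail y' t u := by
  unfold avail
  congr 1
  exact Finset.sum_congr rfl fun τ hτ => by rw [h τ (Finset.mem_filter.1 hτ).2]

/-- The matching `y` of arrival `t` is nonnegative and pays at least the price of every unit of a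
neighbour that is still available. -/
def IsGreedyAt [Fintype I] (y : G.Units → Fin n → ℝ) (t : Fin n) : Prop :=
  (∀ u, 0 ≤ y u t) ∧
    ∀ v, G.edge v.1 t → 0 < G.avail y t v → G.price v ≤ ∑ u, y u t * G.price u

/-- The invariant of the algorithm after `m` arrivals. -/
structure GuideInvariant [Fintype I] (m : ℕ) (s : G.GuideState) : Prop where
  initial : m = 0 → ∀ u, s.Y u = 1
  inventory : ∀ t : Fin n, (t : ℕ) + 1 = m → ∀ u, s.Y u = G.avail s.y t u
  greedy : ∀ t : Fin n, (t : ℕ) < m → IsGreedyAt s.y t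

/-- The increments of the returned proportion telescope: each earlier match enters with the
proportion in use at the previous arrival, and the update replaces it by the one at `t`. -/
theorem GuideInvariant.fluidUpdate_eq [Fintype I] {t : Fin n} {s : G.GuideState}
    (h : GuideInvariant (t : ℕ) s) (u : G.Units) :
    G.fluidUpdate t s u = 1 - ∑ τ with τ < t, G.inUse u.1 t τ * s.y u τ := by
  unfold fluidUpdate
  rcases Nat.eq_zero_or_pos (t : ℕ) with h0 | h0
  · have he : (Finset.univ.filter fun τ : Fin n => τ < t) = ∅ :=
      Finset.filter_false_of_mem fun τ _ => by simp [Fin.lt_def, h0]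
    rw [h.initial h0, he]
    simp
  · have hlt : (t : ℕ) - 1 < n := by omega
    have he : (Finset.univ.filter fun τ : Fin n => τ ≤ ⟨(t : ℕ) - 1, hlt⟩) =
        Finset.univ.filter fun τ : Fin n => τ < t := by
      ext τ
      simp only [Finset.mem_filter, Finset.mem_univ, true_and, Fin.lt_def, Fin.le_def]
      omega
    rw [h.inventory ⟨(t : ℕ) - 1, hlt⟩ (by dsimp only; omega) u, avail, he, sub_add,
      ← Finset.sum_sub_distrib]
    congr 1
    refine Finset.sum_congr rfl fun τ _ => ?_
    unfold inUse
    ring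

theorem GuideInvariant.arrivalStep [Fintype I] {sel : Fin n → G.LoopState → G.Units}
    (hsel : G.IsGreedyRule sel) {t : Fin n} {s : G.GuideState}
    (h : GuideInvariant (t : ℕ) s) : GuideInvariant ((t : ℕ) + 1) (G.arrivalStep sel t s) := by
  have hinv := (loopInvariant_init t (G.fluidUpdate t s)).loop hsel
  have hend := G.loop_ended hsel t { η := 0, Y := G.fluidUpdate t s, y := fun _ => 0 }
  unfold ReusableInstance.arrivalStep
  set st := G.loop sel t { η := 0, Y := G.fluidUpdate t s, y := fun _ => 0 } with hst
  have hav : ∀ u, st.Y u = G.avail (fun u => Function.update (s.y u) t (st.y u)) t u := by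
    intro u
    have he : (Finset.univ.filter fun τ : Fin n => τ ≤ t) =
        insert t (Finset.univ.filter fun τ : Fin n => τ < t) := by
      ext τ
      simp [le_iff_eq_or_lt]
    have h1 := hinv.add_eq u
    rw [h.fluidUpdate_eq u] at h1
    have h2 : ∑ τ with τ < t, G.inUse u.1 t τ * Function.update (s.y u) t (st.y u) τ =
        ∑ τ with τ < t, G.inUse u.1 t τ * s.y u τ :=
      Finset.sum_congr rfl fun τ hτ => by
        rw [Function.update_of_ne (Finset.mem_filter.1 hτ).2.ne]
    rw [avail, he, Finset.sum_insert (by simp), h2, G.inUse_self, Function.update_self]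
    linarith
  refine ⟨by simp, fun t' ht' u => ?_, fun t' ht' => ?_⟩
  · obtain rfl : t' = t := Fin.ext (by omega)
    exact hav u
  · rcases (Nat.lt_succ_iff.1 ht').eq_or_lt with heq | hlt
    · obtain rfl : t' = t := Fin.ext heq
      refine ⟨fun u => by simpa using hinv.nonneg u, fun v hv hpos => ?_⟩
      have := hinv.price_le_sum hend hv ((hav v).symm ▸ hpos)
      simpa using this
    -- Availability at an earlier arrival involves only matches up to it, so writing entry `t`
    -- leaves it unchanged.
    · have hne : ∀ τ ≤ t', τ ≠ t := fun τ hτ => (lt_of_le_of_lt hτ hlt).ne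
      obtain ⟨hn, hp⟩ := h.greedy t' hlt
      refine ⟨fun u => ?_, fun v hv hpos => ?_⟩
      · simpa [Function.update_of_ne (hne t' le_rfl)] using hn u
      · have hc : G.avail (fun u => Function.update (s.y u) t (st.y u)) t' v =
            G.avail s.y t' v :=
          avail_congr fun τ hτ => Function.update_of_ne (hne τ hτ) _ _
        have := hp v hv (hc ▸ hpos)
        simpa [Function.update_of_ne (hne t' le_rfl)] using this

theorem guideInvariant_guideState [Fintype I] {sel : Fin n → G.LoopState → G.Units}
    (hsel : G.IsGreedyRule sel) (m : ℕ) (hm : m ≤ n) :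
    GuideInvariant m (G.guideState sel m) := by
  induction m with
  | zero => exact ⟨fun _ _ => rfl, by simp, by simp⟩
  | succ m ih =>
    rw [guideState, dif_pos (show m < n by omega)]
    exact GuideInvariant.arrivalStep (t := ⟨m, by omega⟩) hsel (ih (by omega))

theorem isGreedyAt_guideState [Fintype I] {sel : Fin n → G.LoopState → G.Units}
    (hsel : G.IsGreedyRule sel) (t : Fin n) : IsGreedyAt (G.guideState sel n).y t :=
  (guideInvariant_guideState hsel n le_rfl).greedy t t.2

end ReusableInstance

/-! ### Independence of decisions and durations -/

/-- Under a product measure, a set that is insensitive to coordinate `p` is independent of every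
event about coordinate `p`. -/
theorem measureReal_pi_inter_eq_mul {ι : Type*} [Fintype ι] [DecidableEq ι] {X : ι → Type*}
    [∀ p, MeasurableSpace (X p)] (μ : ∀ p, Measure (X p)) [∀ p, IsProbabilityMeasure (μ p)]
    (p : ι) {B : Set (∀ p, X p)} (hB : MeasurableSet B)
    (hinv : ∀ d x, Function.update d p x ∈ B ↔ d ∈ B) {D : Set (X p)} (hD : MeasurableSet D) :
    (Measure.pi μ).real (B ∩ {d | d p ∈ D}) = (Measure.pi μ).real B * (μ p).real D := by
  classical
  have : Nonempty (X p) := (μ p).nonempty_of_neZero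
  obtain ⟨x₀⟩ := this
  have hind : ProbabilityTheory.iIndepFun (fun q (d : ∀ q, X q) => d q) (Measure.pi μ) :=
    ProbabilityTheory.iIndepFun_pi (X := fun _ => id) fun _ => aemeasurable_id
  have hpair := hind.indepFun_finset (Finset.univ.erase p) {p} (by simp)
    fun q => measurable_pi_apply q
  -- Filling coordinate `p` with a fixed value exhibits `B` as an event about the other coordinates.
  let ext : (∀ q : (Finset.univ.erase p : Finset ι), X q) → ∀ q, X q := fun g q =>
    if h : q = p then h ▸ x₀ else g ⟨q, by simp [h]⟩
  have hext : Measurable ext := by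
    refine measurable_pi_lambda _ fun q => ?_
    by_cases h : q = p
    · simp only [ext, h, dite_true]; exact measurable_const
    · simp only [ext, h, dite_false]; exact measurable_pi_apply _
  have hupd : ∀ d : ∀ q, X q, ext (fun q => d q) = Function.update d p x₀ := by
    intro d
    funext q
    by_cases h : q = p
    · subst h; simp [ext]
    · simp [ext, h]
  have h1 : B = (fun (d : ∀ q, X q) (q : (Finset.univ.erase p : Finset ι)) => d q) ⁻¹'
      (ext ⁻¹' B) := by
    ext d
    rw [Set.mem_preimage, Set.mem_preimage, hupd, hinv]
  have h2 : {d : ∀ q, X q | d p ∈ D} =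
      (fun (d : ∀ q, X q) (q : ({p} : Finset ι)) => d q) ⁻¹'
        ((fun g => g ⟨p, Finset.mem_singleton_self p⟩) ⁻¹' D) := rfl
  have h3 := hpair.measure_inter_preimage_eq_mul (ext ⁻¹' B)
    ((fun g => g ⟨p, Finset.mem_singleton_self p⟩) ⁻¹' D) (hext hB)
    (measurable_pi_apply _ hD)
  rw [← h1, ← h2] at h3
  have h4 : Measure.pi μ {d : ∀ q, X q | d p ∈ D} = μ p D :=
    (measurePreserving_eval μ p).measure_preimage hD.nullMeasurableSet
  rw [h4] at h3
  simp only [measureReal_def, h3, ENNReal.toReal_mul]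

namespace ReusableInstance

variable {I : Type*} {n : ℕ} {G : ReusableInstance I n}

instance [Fintype I] : IsProbabilityMeasure G.durationLaw := by
  have := G.F_prob
  unfold durationLaw
  infer_instance

/-! ### Expected load of a clairvoyant policy -/

namespace Policy

variable (P : G.Policy)

/-- A decision depends only on the durations of earlier matches. -/
theorem assign_congr {d d' : G.Durations} (t : Fin n)
    (h : ∀ s < t, ∀ i, d (i, s) = d' (i, s)) : P.assign d t = P.assign d' t := by
  induction t using WellFoundedLT.induction with
  | _ t ih =>
    exact P.nonanticipating d d' t fun s hs =>
      ⟨ih s hs fun s' hs' => h s' (hs'.trans hs), fun i _ => Or.inl (h s hs i)⟩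

/-- The units of `i` that are in use when `t` arrives. -/
def busy (d : G.Durations) (i : I) (t : Fin n) : Set (Fin n) :=
  {s | s < t ∧ P.assign d s = some i ∧ ENNReal.ofReal (G.a t - G.a s) < d (i, s)}

/-- Capacity is only imposed at arrivals matched to `i`. At the latest match `s` that is still in
use, all the others were already in use, so they number fewer than `c i`; adding `s` gives the
bound. -/
theorem ncard_busy_le (d : G.Durations) (i : I) (t : Fin n) : (P.busy d i t).ncard ≤ G.c i := by
  rcases (P.busy d i t).eq_empty_or_nonempty with he | hne
  · simp [he]
  · obtain ⟨s, hs, hmax⟩ := (P.busy d i t).toFinite.exists_maximal hne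
    have hsub : P.busy d i t \ {s} ⊆ P.busy d i s := by
      rintro τ ⟨hτ, hne⟩
      have hlt : τ < s := lt_of_le_of_ne (not_lt.1 fun h => (hmax hτ h.le).not_gt h) hne
      refine ⟨hlt, hτ.2.1, lt_of_le_of_lt (ENNReal.ofReal_le_ofReal ?_) hτ.2.2⟩
      linarith [G.a_mono hs.1.le]
    have h1 := Set.ncard_le_ncard hsub (Set.toFinite _)
    have h2 : (P.busy d i s).ncard < G.c i := P.capacity d s i hs.2.1
    have h3 := Set.ncard_sdiff_singleton_add_one hs (Set.toFinite _)
    omega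

theorem measurableSet_busy (i : I) (τ t : Fin n) : MeasurableSet {d | τ ∈ P.busy d i t} := by
  have h1 := P.measurableSet_assign τ i
  have h2 : MeasurableSet {d : G.Durations | ENNReal.ofReal (G.a t - G.a τ) < d (i, τ)} :=
    measurableSet_lt measurable_const (measurable_pi_apply _)
  exact (MeasurableSet.const (τ < t)).inter (h1.inter h2)

variable [Fintype I]

/-- The probability that the policy matches `t` to `i`. -/
noncomputable def matchProb (i : I) (t : Fin n) : ℝ := G.durationLaw.real {d | P.assign d t = some i}

theorem matchProb_nonneg (i : I) (t : Fin n) : 0 ≤ P.matchProb i t := measureReal_nonneg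

theorem matchProb_eq_zero {i : I} {t : Fin n} (h : ¬ G.edge i t) : P.matchProb i t = 0 := by
  have : {d | P.assign d t = some i} = ∅ :=
    Set.eq_empty_of_forall_notMem fun d hd => h (P.edge_of_assign d t i hd)
  simp [matchProb, this]

theorem sum_matchProb_le_one (t : Fin n) : ∑ i, P.matchProb i t ≤ 1 := by
  unfold matchProb
  rw [← measureReal_biUnion_finset (fun i _ j _ hij => ?_)
    fun i _ => P.measurableSet_assign t i]
  · exact measureReal_le_one
  · refine Set.disjoint_left.2 fun d (hi : _ = _) (hj : _ = _) => hij ?_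
    exact Option.some_injective _ (hi.symm.trans hj)

/-- The decision at `τ` depends only on durations of earlier arrivals, so it is independent of `d
(i, τ)` and the probability factorizes. -/
theorem measureReal_busy (i : I) {τ t : Fin n} (h : τ < t) :
    G.durationLaw.real {d | τ ∈ P.busy d i t} = G.inUse i t τ * P.matchProb i τ := by
  classical
  have := G.F_prob
  have hset : {d | τ ∈ P.busy d i t} = {d | P.assign d τ = some i} ∩
      {d | d (i, τ) ∈ (Set.Iic (ENNReal.ofReal (G.a t - G.a τ)))ᶜ} := by
    ext d
    simp [busy, h]
  rw [hset]
  unfold matchProb durationLaw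
  rw [measureReal_pi_inter_eq_mul (fun p : I × Fin n => G.F p.1) (i, τ)
    (P.measurableSet_assign τ i) (fun d x => ?_) measurableSet_Iic.compl,
    probReal_compl_eq_one_sub measurableSet_Iic, mul_comm]
  · simp [inUse, returned, h, cdf, measureReal_def]
  · have : P.assign (Function.update d (i, τ) x) τ = P.assign d τ :=
      P.assign_congr τ fun s hs j => Function.update_of_ne (fun he => hs.ne (congrArg Prod.snd he)) _ _
    simp only [Set.mem_ofPred_eq, this]

/-- The expected number of units of `i` in use just after the matching of `t` is at most `c i`. -/
theorem sum_inUse_mul_matchProb_le (i : I) (t : Fin n) :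
    ∑ τ with τ ≤ t, G.inUse i t τ * P.matchProb i τ ≤ G.c i := by
  classical
  have he : (Finset.univ.filter fun τ : Fin n => τ ≤ t) =
      insert t (Finset.univ.filter fun τ : Fin n => τ < t) := by
    ext τ
    simp [le_iff_eq_or_lt]
  -- The match of `t` itself counts as in use whatever its duration, in accordance with the unit
  -- diagonal of `inUse`.
  let B : Fin n → Set G.Durations := fun τ =>
    if τ = t then {d | P.assign d t = some i} else {d | τ ∈ P.busy d i t}
  have hBm : ∀ τ, MeasurableSet (B τ) := by
    intro τ
    by_cases h : τ = t
    · simpa only [B, h, if_true] using P.measurableSet_assign t i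
    · simpa only [B, h, if_false] using P.measurableSet_busy i τ t
  have hBr : ∀ τ ∈ Finset.univ.filter (fun τ : Fin n => τ ≤ t),
      G.inUse i t τ * P.matchProb i τ = ∫ d, (B τ).indicator (fun _ => (1 : ℝ)) d ∂G.durationLaw := by
    intro τ hτ
    rw [integral_indicator (hBm τ), setIntegral_const, smul_eq_mul, mul_one]
    rcases (Finset.mem_filter.1 hτ).2.eq_or_lt with rfl | hlt
    · simp [B, inUse_self, matchProb]
    · simp [B, hlt.ne, P.measureReal_busy i hlt]
  rw [Finset.sum_congr rfl hBr, ← integral_finsetSum _ fun τ _ =>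
    (integrable_const (1 : ℝ)).indicator (hBm τ)]
  have hpt : ∀ d, ∑ τ with τ ≤ t, (B τ).indicator (fun _ => (1 : ℝ)) d ≤ G.c i := by
    intro d
    have hsum : ∑ τ with τ < t, (B τ).indicator (fun _ => (1 : ℝ)) d =
        ((P.busy d i t).ncard : ℝ) := by
      have : P.busy d i t =
          ((Finset.univ.filter fun τ : Fin n => τ < t).filter fun τ => d ∈ B τ : Finset (Fin n)) := by
        ext τ
        simp only [Finset.coe_filter, Finset.mem_filter, Finset.mem_univ, true_and,
          Set.mem_ofPred_eq]
        constructor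
        · intro h
          exact ⟨h.1, by simpa [B, h.1.ne] using h⟩
        · rintro ⟨h1, h2⟩
          simpa [B, h1.ne] using h2
      rw [this, Set.ncard_coe_finset, Finset.card_filter]
      push_cast
      exact Finset.sum_congr rfl fun τ _ => by simp [Set.indicator_apply]
    rw [he, Finset.sum_insert (by simp), hsum]
    by_cases ha : P.assign d t = some i
    · have h1 : (P.busy d i t).ncard < G.c i := P.capacity d t i ha
      have h2 : (B t).indicator (fun _ => (1 : ℝ)) d = 1 := by simp [B, ha]
      rw [h2]
      exact_mod_cast (by omega : 1 + (P.busy d i t).ncard ≤ G.c i)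
    · have h2 : (B t).indicator (fun _ => (1 : ℝ)) d = 0 := by simp [B, ha]
      rw [h2, zero_add]
      exact_mod_cast P.ncard_busy_le d i t
  have hint := integral_mono (μ := G.durationLaw)
    (integrable_finsetSum _ fun τ _ => (integrable_const (1 : ℝ)).indicator (hBm τ))
    (integrable_const (G.c i : ℝ)) hpt
  simpa using hint

theorem reward_eq : P.reward = ∑ i, G.r i * ∑ t, P.matchProb i t := by
  classical
  have hpt : ∀ d, G.assignReward (P.assign d) =
      ∑ i, ∑ t, {d | P.assign d t = some i}.indicator (fun _ => G.r i) d := by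
    intro d
    rw [assignReward, Finset.sum_comm]
    refine Finset.sum_congr rfl fun t _ => ?_
    rcases h : P.assign d t with _ | i
    · simp [h]
    · simp [Set.indicator_apply, h]
  have hint : ∀ i t, Integrable ({d | P.assign d t = some i}.indicator fun _ => G.r i)
      G.durationLaw := fun i t =>
    (integrable_const (G.r i)).indicator (P.measurableSet_assign t i)
  unfold reward
  simp_rw [hpt]
  rw [integral_finsetSum _ fun i _ => integrable_finsetSum _ fun t _ => hint i t]
  refine Finset.sum_congr rfl fun i _ => ?_
  rw [integral_finsetSum _ fun t _ => hint i t, Finset.mul_sum]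
  refine Finset.sum_congr rfl fun t _ => ?_
  rw [integral_indicator (P.measurableSet_assign t i), setIntegral_const, smul_eq_mul, mul_comm]
  rfl

end Policy

/-! ### Discounts and the discreteness loss -/

variable (G) in
/-- The share `e^{-k / c_i}` of the reward of the unit of `i` of rank `k` beyond its reduced price. -/
noncomputable def discount (i : I) (k : Fin (G.c i)) : ℝ :=
  Real.exp (-(((k : ℕ) + 1 : ℝ) / (G.c i : ℝ)))

variable (G) in
/-- The loss factor `c_i (e^{1 / c_i} - 1)` caused by the discreteness of the ranks. -/
noncomputable def lossFactor (i : I) : ℝ := (G.c i : ℝ) * (Real.exp (1 / (G.c i : ℝ)) - 1)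

theorem one_le_lossFactor (i : I) : 1 ≤ G.lossFactor i := by
  have hc : (0 : ℝ) < G.c i := by exact_mod_cast G.c_pos i
  calc (1 : ℝ) = G.c i * (1 / G.c i) := by field_simp
    _ ≤ _ := mul_le_mul_of_nonneg_left
      (by linarith [Real.add_one_le_exp (1 / (G.c i : ℝ))]) hc.le

/-- With x = 1/c_i, this is e^x - 1 = e^x (1 - e^{-x}) ≤ x e^x. -/
theorem lossFactor_le_exp (i : I) : G.lossFactor i ≤ Real.exp (1 / (G.c i : ℝ)) := by
  have hc : (0 : ℝ) < G.c i := by exact_mod_cast G.c_pos i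
  have h1 := Real.add_one_le_exp (-(1 / (G.c i : ℝ)))
  have h2 : Real.exp (1 / (G.c i : ℝ)) * Real.exp (-(1 / (G.c i : ℝ))) = 1 := by
    rw [← Real.exp_add]; simp
  have h3 := mul_le_mul_of_nonneg_left h1
    (mul_nonneg hc.le (Real.exp_pos (1 / (G.c i : ℝ))).le)
  have h4 : (G.c i : ℝ) * (1 / G.c i) = 1 := by field_simp
  unfold lossFactor
  linear_combination h3 + G.c i * h2 + Real.exp (1 / (G.c i : ℝ)) * h4

theorem sum_range_ite_sub {f : ℕ → ℝ} {m N : ℕ} (h : m ≤ N) :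
    ∑ k ∈ Finset.range N, (if m ≤ k then f k - f (k + 1) else 0) = f m - f N := by
  induction N, h using Nat.le_induction with
  | base =>
    rw [sub_self]
    exact Finset.sum_eq_zero fun k hk => if_neg (not_le.2 (Finset.mem_range.1 hk))
  | succ N hN ih =>
    rw [Finset.sum_range_succ, ih, if_pos hN]
    ring

/-- Telescoping: index `k` stands for rank k + 1, and e^{-k/c} - e^{-(k+1)/c} = (e^{1/c} - 1)
e^{-(k+1)/c}. The factor e^{1/c} - 1, in place of 1/c, is the source of the loss. -/
theorem sum_discount (i : I) {m : ℕ} (hm : m ≤ G.c i) :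
    (Real.exp (1 / (G.c i : ℝ)) - 1) * ∑ k with m ≤ ((k : Fin (G.c i)) : ℕ), G.discount i k =
      Real.exp (-((m : ℝ) / (G.c i : ℝ))) - Real.exp (-1) := by
  have hc : (0 : ℝ) < G.c i := by exact_mod_cast G.c_pos i
  have h := sum_range_ite_sub (f := fun k : ℕ => Real.exp (-((k : ℝ) / (G.c i : ℝ)))) hm
  rw [← Fin.sum_univ_eq_sum_range
    (fun k : ℕ => if m ≤ k then Real.exp (-((k : ℝ) / (G.c i : ℝ))) -
      Real.exp (-(((k + 1 : ℕ) : ℝ) / (G.c i : ℝ))) else 0), div_self hc.ne'] at h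
  rw [← h, Finset.sum_filter, Finset.mul_sum]
  refine Finset.sum_congr rfl fun k _ => ?_
  split_ifs
  · rw [discount, sub_one_mul, ← Real.exp_add]
    push_cast
    congr 2
    field_simp
    ring
  · simp

/-! ### The dual certificate -/

variable [Fintype I]

/-- The reduced price collected by the matching `y` at arrival `t`. -/
noncomputable def payment (y : G.Units → Fin n → ℝ) (t : Fin n) : ℝ := ∑ u, y u t * G.price u

theorem payment_nonneg {y : G.Units → Fin n → ℝ} {t : Fin n} (h : IsGreedyAt y t) :
    0 ≤ payment y t :=
  Finset.sum_nonneg fun u _ => mul_nonneg (h.1 u) (G.price_nonneg u)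

/-- The payment of a neighbour of `i` covers the reward of `i`, up to the discounts of the depleted
units of `i`. -/
theorem r_le_payment_add {y : G.Units → Fin n → ℝ} {t : Fin n} (h : IsGreedyAt y t) {i : I}
    (hi : G.edge i t) :
    G.r i ≤ payment y t + G.r i * (Real.exp (-1) + (Real.exp (1 / (G.c i : ℝ)) - 1) *
      ∑ k with G.avail y t ⟨i, k⟩ ≤ 0, G.discount i k) := by
  classical
  -- `m` is the highest available rank counted from 1, or 0 if every unit is depleted; in that case
  -- the price bound is trivial.
  obtain ⟨m, hm, hdep, hpay⟩ : ∃ m ≤ G.c i,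
      (∀ k : Fin (G.c i), m ≤ (k : ℕ) → G.avail y t ⟨i, k⟩ ≤ 0) ∧
      G.r i * (1 - Real.exp (-((m : ℝ) / (G.c i : ℝ)))) ≤ payment y t := by
    by_cases hex : ∃ k : Fin (G.c i), 0 < G.avail y t ⟨i, k⟩
    · obtain ⟨k, hk⟩ := hex
      obtain ⟨z, hz, hmax⟩ := Finset.exists_max_image
        (Finset.univ.filter fun k : Fin (G.c i) => 0 < G.avail y t ⟨i, k⟩) id
        ⟨k, by simpa using hk⟩
      refine ⟨z + 1, z.2, fun k hk => not_lt.1 fun hpos => ?_, ?_⟩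
      · have : k ≤ z := hmax k (by simpa using hpos)
        exact absurd (Fin.le_def.1 this) (by omega)
      · have := h.2 ⟨i, z⟩ hi (Finset.mem_filter.1 hz).2
        simpa [price, payment] using this
    · push Not at hex
      refine ⟨0, Nat.zero_le _, fun k _ => hex k, ?_⟩
      simpa using payment_nonneg h
  have hq : 0 ≤ Real.exp (1 / (G.c i : ℝ)) - 1 :=
    sub_nonneg.2 (Real.one_le_exp (by positivity))
  have hsub : ∑ k with m ≤ ((k : Fin (G.c i)) : ℕ), G.discount i k ≤
      ∑ k with G.avail y t ⟨i, k⟩ ≤ 0, G.discount i k :=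
    Finset.sum_le_sum_of_subset_of_nonneg
      (Finset.monotone_filter_right _ fun k _ hk => hdep k hk) fun k _ _ => (Real.exp_pos _).le
  have h1 := mul_le_mul_of_nonneg_left (mul_le_mul_of_nonneg_left hsub hq) (G.r_nonneg i)
  rw [sum_discount i hm] at h1
  linarith

/-- The approximate dual constraint of resource `i`. -/
theorem dual_feasible {y : G.Units → Fin n → ℝ} (h : ∀ t, IsGreedyAt y t) (P : G.Policy) (i : I) :
    (1 - Real.exp (-1)) * (G.r i * ∑ t, P.matchProb i t) ≤
      ∑ t, P.matchProb i t * payment y t +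
        G.lossFactor i * (G.r i * ∑ k, G.discount i k * ∑ t, y ⟨i, k⟩ t) := by
  classical
  have hq : 0 ≤ Real.exp (1 / (G.c i : ℝ)) - 1 :=
    sub_nonneg.2 (Real.one_le_exp (by positivity))
  -- The charging step: depletion of unit `k` at `t` says that its row is loaded by at least 1,
  -- while the policy loads every row by at most `c i`.
  have hunit : ∀ k : Fin (G.c i), ∑ t with G.avail y t ⟨i, k⟩ ≤ 0, P.matchProb i t ≤
      G.c i * ∑ t, y ⟨i, k⟩ t := fun k =>
    sum_le_mul_sum_of_load (G.inUse i) (G.inUse_self i) (G.inUse_mono i) (G.inUse_nonneg i)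
      (Nat.cast_nonneg _) _ _ _ (P.matchProb_nonneg i) (fun t => (h t).1 ⟨i, k⟩)
      (P.sum_inUse_mul_matchProb_le i) fun t ht => by
        have := (Finset.mem_filter.1 ht).2
        unfold avail at this
        linarith
  have hpt : ∀ t, P.matchProb i t * G.r i ≤ P.matchProb i t * (payment y t +
      G.r i * (Real.exp (-1) + (Real.exp (1 / (G.c i : ℝ)) - 1) *
        ∑ k with G.avail y t ⟨i, k⟩ ≤ 0, G.discount i k)) := by
    intro t
    by_cases hi : G.edge i t
    · exact mul_le_mul_of_nonneg_left (r_le_payment_add (h t) hi) (P.matchProb_nonneg i t)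
    · simp [P.matchProb_eq_zero hi]
  have hswap : ∑ t, P.matchProb i t * ∑ k with G.avail y t ⟨i, k⟩ ≤ 0, G.discount i k =
      ∑ k, G.discount i k * ∑ t with G.avail y t ⟨i, k⟩ ≤ 0, P.matchProb i t := by
    simp_rw [Finset.sum_filter, Finset.mul_sum]
    rw [Finset.sum_comm]
    refine Finset.sum_congr rfl fun k _ => Finset.sum_congr rfl fun t _ => ?_
    split_ifs <;> ring
  have hle : ∑ k, G.discount i k * ∑ t with G.avail y t ⟨i, k⟩ ≤ 0, P.matchProb i t ≤
      G.c i * ∑ k, G.discount i k * ∑ t, y ⟨i, k⟩ t := by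
    rw [Finset.mul_sum]
    refine Finset.sum_le_sum fun k _ => ?_
    have := mul_le_mul_of_nonneg_left (hunit k) (Real.exp_pos (-(((k : ℕ) + 1 : ℝ) / G.c i))).le
    unfold discount
    linarith
  have hsum := Finset.sum_le_sum fun t (_ : t ∈ Finset.univ) => hpt t
  have hexp : ∑ t, P.matchProb i t * (payment y t +
      G.r i * (Real.exp (-1) + (Real.exp (1 / (G.c i : ℝ)) - 1) *
        ∑ k with G.avail y t ⟨i, k⟩ ≤ 0, G.discount i k)) =
      ∑ t, P.matchProb i t * payment y t + G.r i * Real.exp (-1) * ∑ t, P.matchProb i t +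
        G.r i * (Real.exp (1 / (G.c i : ℝ)) - 1) *
          ∑ t, P.matchProb i t * ∑ k with G.avail y t ⟨i, k⟩ ≤ 0, G.discount i k := by
    rw [Finset.mul_sum, Finset.mul_sum, ← Finset.sum_add_distrib, ← Finset.sum_add_distrib]
    exact Finset.sum_congr rfl fun t _ => by ring
  rw [hexp, hswap, ← Finset.sum_mul] at hsum
  have h2 := mul_le_mul_of_nonneg_left hle (mul_nonneg (G.r_nonneg i) hq)
  unfold lossFactor
  linarith

/-- The reward of the algorithm splits into the payments and the discounts. -/
theorem guide_eq (sel : Fin n → G.LoopState → G.Units) :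
    G.guide sel = ∑ t, payment (G.guideState sel n).y t +
      ∑ i, G.r i * ∑ k, G.discount i k * ∑ t, (G.guideState sel n).y ⟨i, k⟩ t := by
  have h1 : ∑ t, payment (G.guideState sel n).y t =
      ∑ i, ∑ k, G.price ⟨i, k⟩ * ∑ t, (G.guideState sel n).y ⟨i, k⟩ t := by
    unfold payment
    rw [Finset.sum_comm, Fintype.sum_sigma]
    refine Finset.sum_congr rfl fun i _ => Finset.sum_congr rfl fun k _ => ?_
    rw [Finset.mul_sum]
    exact Finset.sum_congr rfl fun t _ => mul_comm _ _
  rw [h1, ← Finset.sum_add_distrib]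
  refine Finset.sum_congr rfl fun i _ => ?_
  rw [← Finset.mul_sum]
  unfold guideMatch
  rw [Finset.sum_comm, Finset.mul_sum, Finset.mul_sum, ← Finset.sum_add_distrib]
  refine Finset.sum_congr rfl fun k _ => ?_
  unfold price discount
  ring

/-- A factor below every reciprocal loss factor bounds the algorithm against every policy. -/
theorem mul_reward_le_guide [Nonempty I] {sel : Fin n → G.LoopState → G.Units}
    (hsel : G.IsGreedyRule sel) {α : ℝ} (hα : 0 ≤ α) (hle : ∀ i, α ≤ (G.lossFactor i)⁻¹)
    (P : G.Policy) : α * (1 - Real.exp (-1)) * P.reward ≤ G.guide sel := by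
  have hg := isGreedyAt_guideState hsel
  set y := (G.guideState sel n).y with hy
  have hpos : ∀ i, 0 < G.lossFactor i := fun i => one_pos.trans_le (one_le_lossFactor i)
  -- The payments carry no loss factor, so scaling them needs only `α ≤ 1`.
  have hα1 : α ≤ 1 := (hle (Classical.arbitrary I)).trans (inv_le_one_of_one_le₀ (one_le_lossFactor _))
  have hθ : ∀ i, 0 ≤ G.r i * ∑ k, G.discount i k * ∑ t, y ⟨i, k⟩ t := fun i =>
    mul_nonneg (G.r_nonneg i) (Finset.sum_nonneg fun k _ =>
      mul_nonneg (Real.exp_pos _).le (Finset.sum_nonneg fun t _ => (hg t).1 _))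
  have hpay : ∑ i, ∑ t, P.matchProb i t * payment y t ≤ ∑ t, payment y t := by
    rw [Finset.sum_comm]
    refine Finset.sum_le_sum fun t _ => ?_
    rw [← Finset.sum_mul]
    exact mul_le_of_le_one_left (payment_nonneg (hg t)) (P.sum_matchProb_le_one t)
  have hpay0 : 0 ≤ ∑ i, ∑ t, P.matchProb i t * payment y t :=
    Finset.sum_nonneg fun i _ => Finset.sum_nonneg fun t _ =>
      mul_nonneg (P.matchProb_nonneg i t) (payment_nonneg (hg t))
  have hdisc : ∀ i, α * (G.lossFactor i * (G.r i * ∑ k, G.discount i k * ∑ t, y ⟨i, k⟩ t)) ≤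
      G.r i * ∑ k, G.discount i k * ∑ t, y ⟨i, k⟩ t := by
    intro i
    rw [← mul_assoc]
    refine mul_le_of_le_one_left (hθ i) ?_
    calc α * G.lossFactor i ≤ (G.lossFactor i)⁻¹ * G.lossFactor i :=
          mul_le_mul_of_nonneg_right (hle i) (hpos i).le
      _ = 1 := inv_mul_cancel₀ (hpos i).ne'
  calc α * (1 - Real.exp (-1)) * P.reward
      = α * ∑ i, (1 - Real.exp (-1)) * (G.r i * ∑ t, P.matchProb i t) := by
        rw [P.reward_eq, mul_assoc, Finset.mul_sum]
    _ ≤ α * ∑ i, (∑ t, P.matchProb i t * payment y t +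
        G.lossFactor i * (G.r i * ∑ k, G.discount i k * ∑ t, y ⟨i, k⟩ t)) :=
        mul_le_mul_of_nonneg_left (Finset.sum_le_sum fun i _ => dual_feasible hg P i) hα
    _ = α * ∑ i, ∑ t, P.matchProb i t * payment y t +
        ∑ i, α * (G.lossFactor i * (G.r i * ∑ k, G.discount i k * ∑ t, y ⟨i, k⟩ t)) := by
        rw [Finset.sum_add_distrib, mul_add, ← Finset.mul_sum]
    _ ≤ ∑ t, payment y t + ∑ i, G.r i * ∑ k, G.discount i k * ∑ t, y ⟨i, k⟩ t :=
        add_le_add ((mul_le_of_le_one_left hpay0 hα1).trans hpay)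
          (Finset.sum_le_sum fun i _ => hdisc i)
    _ = G.guide sel := (guide_eq sel).symm

theorem opt_nonneg : 0 ≤ G.opt :=
  Real.iSup_nonneg fun P => by
    rw [P.reward_eq]
    exact Finset.sum_nonneg fun i _ => mul_nonneg (G.r_nonneg i)
      (Finset.sum_nonneg fun t _ => P.matchProb_nonneg i t)

end ReusableInstance

theorem lemma3p2 {I : Type*} [Fintype I] [Nonempty I] {n : ℕ} (G : ReusableInstance I n)
    (sel : Fin n → G.LoopState → G.Units) (hsel : G.IsGreedyRule sel) :
    G.guide sel ≥
        Finset.univ.inf' Finset.univ_nonempty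
            (fun i : I => ((G.c i : ℝ) * (Real.exp (1 / (G.c i : ℝ)) - 1))⁻¹) *
          (1 - 1 / Real.exp 1) * G.opt ∧
      Finset.univ.inf' Finset.univ_nonempty
            (fun i : I => ((G.c i : ℝ) * (Real.exp (1 / (G.c i : ℝ)) - 1))⁻¹) *
          (1 - 1 / Real.exp 1) * G.opt ≥
        Real.exp (-(1 / ((Finset.univ.inf' Finset.univ_nonempty G.c : ℕ) : ℝ))) *
          (1 - 1 / Real.exp 1) * G.opt := by
  have he : 1 - 1 / Real.exp 1 = 1 - Real.exp (-1) := by rw [Real.exp_neg, one_div]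
  have he0 : 0 ≤ 1 - Real.exp (-1) := sub_nonneg.2 (Real.exp_le_one_iff.2 (by norm_num))
  rw [he]
  set α := Finset.univ.inf' Finset.univ_nonempty
    (fun i : I => ((G.c i : ℝ) * (Real.exp (1 / (G.c i : ℝ)) - 1))⁻¹) with hα
  -- Each loss factor is at most e^{1/c_i}, which is largest at the smallest capacity.
  have hexp : Real.exp (-(1 / ((Finset.univ.inf' Finset.univ_nonempty G.c : ℕ) : ℝ))) ≤ α := by
    refine Finset.le_inf' _ _ fun i _ => ?_
    have hc0 : 0 < Finset.univ.inf' Finset.univ_nonempty G.c :=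
      (Finset.lt_inf'_iff _).2 fun j _ => G.c_pos j
    have hci : Finset.univ.inf' Finset.univ_nonempty G.c ≤ G.c i :=
      Finset.inf'_le _ (Finset.mem_univ i)
    rw [Real.exp_neg]
    refine inv_anti₀ (one_pos.trans_le (ReusableInstance.one_le_lossFactor i))
      ((ReusableInstance.lossFactor_le_exp i).trans (Real.exp_le_exp.2 ?_))
    exact one_div_le_one_div_of_le (by exact_mod_cast hc0) (by exact_mod_cast hci)
  have hα0 : 0 ≤ α := (Real.exp_pos _).le.trans hexp
  refine ⟨?_, ?_⟩
  · change _ ≤ _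
    rw [ReusableInstance.opt, Real.mul_iSup_of_nonneg (mul_nonneg hα0 he0)]
    exact ciSup_le fun P => ReusableInstance.mul_reward_le_guide hsel hα0
      (fun i => Finset.inf'_le _ (Finset.mem_univ i)) P
  · exact mul_le_mul_of_nonneg_right (mul_le_mul_of_nonneg_right hexp he0)
      ReusableInstance.opt_nonneg
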